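/- Let $E$ be a (real) Banach lattice. A net $(x_\alpha)$ in $E$ is uaw-convergent to $x \in E$ if $|x_\alpha - x| \wedge u \to 0$ weakly for every $u \in E^+$. A subset $A$ of $E$ is relatively uaw-compact if it is norm bounded and every net in $A$ has a subnet that is uaw-convergent to some point of $E$. Then the following statements are equivalent: 1. The lattice operations of $E$ are weakly sequentially continuous, that is, whenever $x_n \to x$ and $y_n \to y$ weakly in $E$, also $x_n \vee y_n \to x \vee y$ and $x_n \wedge y_n \to x \wedge y$ weakly. 2. Every relatively weakly compact subset of $E$ is relatively uaw-compact. -/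

import Mathlib

universe u

open Filter Topology

/-- Weak convergence (for the topology `σ(E, E')`) of a family `x` along a filter `l` to `a`. -/
def WeakTendsto {E : Type*} [NormedAddCommGroup E] [NormedSpace ℝ E] {ι : Type*}
    (x : ι → E) (l : Filter ι) (a : E) : Prop :=
  Tendsto (fun i => toWeakSpace ℝ E (x i)) l (𝓝 (toWeakSpace ℝ E a))

/-- The lattice operations `(x, y) ↦ x ⊔ y` and `(x, y) ↦ x ⊓ y` are weakly sequentially
continuous. -/
def WeaklySeqContinuousLatticeOps (E : Type*) [NormedAddCommGroup E] [NormedSpace ℝ E]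
    [Lattice E] : Prop :=
  ∀ (x y : ℕ → E) (a b : E), WeakTendsto x atTop a → WeakTendsto y atTop b →
    WeakTendsto (fun n => x n ⊔ y n) atTop (a ⊔ b) ∧
    WeakTendsto (fun n => x n ⊓ y n) atTop (a ⊓ b)

/-- Unbounded absolute weak convergence: `|x i - a| ⊓ u → 0` weakly for every `u ≥ 0`. -/
def UawTendsto {E : Type*} [NormedAddCommGroup E] [NormedSpace ℝ E] [Lattice E] {ι : Type*}
    (x : ι → E) (l : Filter ι) (a : E) : Prop :=
  ∀ u : E, 0 ≤ u → WeakTendsto (fun i => |x i - a| ⊓ u) l 0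

/-- The weak closure of `A` is weakly compact. -/
def RelativelyWeaklyCompact {E : Type*} [NormedAddCommGroup E] [NormedSpace ℝ E]
    (A : Set E) : Prop :=
  IsCompact (closure (toWeakSpace ℝ E '' A))

/-- `A` is norm bounded and every net in `A` has a subnet that is uaw-convergent to some point
of `E`. A net is a family indexed by a nonempty directed preordered set; a subnet of `x` is
`x ∘ φ` for a map `φ` from another such set that is eventually above every index. It is enough
to use index sets in the universe of `E`, since every proper filter on `E` is the image filter of a net
with such an index set. -/
def RelativelyUawCompact {E : Type u} [NormedAddCommGroup E] [NormedSpace ℝ E] [Lattice E]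
    (A : Set E) : Prop :=
  Bornology.IsBounded A ∧
  ∀ (ι : Type u) [Preorder ι] [IsDirectedOrder ι] [Nonempty ι] (x : ι → E), (∀ i, x i ∈ A) →
    ∃ (κ : Type u) (_ : Preorder κ) (_ : IsDirectedOrder κ) (_ : Nonempty κ) (φ : κ → ι),
      Tendsto φ atTop atTop ∧ ∃ a : E, UawTendsto (x ∘ φ) atTop a

/-! If 1 holds, `z ↦ |z - a| ⊓ u` is weakly sequentially continuous. Relatively weakly compact sets
are Fréchet-Urysohn, so the map is weakly continuous at `a` along nets in such a set
(`RelativelyWeaklyCompact.weakTendsto_comp`), and weakly convergent subnets are uaw-convergent.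

For the converse, the key is `WeakTendsto.exists_posPart_abs_sub_le`: for `f ≥ 0`, a weakly
convergent sequence `y` satisfies `f (|y n| - u)⁺ ≤ ε` for a single `u`. Otherwise a disjoint
sequence `v k ≤ |y (m k)|` exists with `f (v k)` bounded away from 0. Hahn-Banach yields functionals
`h k` carried by the `v k`, with `f (v k) ≤ h k (y (m k))` and `∑ |h k x| ≤ ‖f‖ * ‖x‖`. They form an
operator into ℓ¹, where weakly convergent sequences have uniformly small tails: a contradiction.
Hence a uaw-limit of a subnet of a weakly null sequence is also its weak limit, so it is 0, and `f
|x n|` cannot stay away from 0. -/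

section WeakTopology

variable {E : Type*} [NormedAddCommGroup E] [NormedSpace ℝ E] {ι : Type*}

/-! ### Weak convergence and boundedness. -/

theorem weakTendsto_iff {x : ι → E} {l : Filter ι} {a : E} :
    WeakTendsto x l a ↔ ∀ φ : StrongDual ℝ E, Tendsto (fun i => φ (x i)) l (𝓝 (φ a)) := by
  refine WeakBilin.tendsto_iff_forall_eval_tendsto _ fun u v h => ?_
  rw [← sub_eq_zero]
  refine SeparatingDual.eq_zero_of_forall_dual_eq_zero (R := ℝ) fun f => ?_
  rw [map_sub, sub_eq_zero]
  exact LinearMap.congr_fun h f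

theorem StrongDual.continuous_weakSpace (φ : StrongDual ℝ E) :
    Continuous fun x : WeakSpace ℝ E => φ ((toWeakSpace ℝ E).symm x) :=
  WeakBilin.eval_continuous _ φ

theorem WeakTendsto.unique {x : ι → E} {l : Filter ι} [l.NeBot] {a b : E}
    (ha : WeakTendsto x l a) (hb : WeakTendsto x l b) : a = b :=
  (toWeakSpace ℝ E).injective (tendsto_nhds_unique ha hb)

theorem WeakTendsto.comp {κ : Type*} {x : ι → E} {l : Filter ι} {a : E} {k : Filter κ} {φ : κ → ι}
    (hx : WeakTendsto x l a) (hφ : Tendsto φ k l) : WeakTendsto (x ∘ φ) k a :=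
  Tendsto.comp (g := fun i => toWeakSpace ℝ E (x i)) hx hφ

theorem WeakTendsto.const (l : Filter ι) (a : E) : WeakTendsto (fun _ => a) l a :=
  tendsto_const_nhds

theorem WeakTendsto.sub {x y : ι → E} {l : Filter ι} {a b : E}
    (hx : WeakTendsto x l a) (hy : WeakTendsto y l b) :
    WeakTendsto (fun i => x i - y i) l (a - b) := by
  rw [weakTendsto_iff] at *
  intro φ
  simpa using (hx φ).sub (hy φ)

theorem WeakTendsto.neg {x : ι → E} {l : Filter ι} {a : E}
    (hx : WeakTendsto x l a) : WeakTendsto (fun i => -x i) l (-a) := by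
  simpa using (WeakTendsto.const l (0 : E)).sub hx

theorem isBounded_of_forall_dual_bounded {A : Set E}
    (h : ∀ φ : StrongDual ℝ E, ∃ C, ∀ a ∈ A, |φ a| ≤ C) : Bornology.IsBounded A := by
  obtain ⟨C, hC⟩ := banach_steinhaus
    (g := fun a : A => NormedSpace.inclusionInDoubleDualLi ℝ (a : E)) fun φ => by
      obtain ⟨C, hC⟩ := h φ
      exact ⟨C, fun a => hC a a.2⟩
  refine isBounded_iff_forall_norm_le.2 ⟨C, fun a ha => ?_⟩
  simpa only [LinearIsometry.norm_map] using hC ⟨a, ha⟩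

theorem RelativelyWeaklyCompact.isBounded {A : Set E} (hA : RelativelyWeaklyCompact A) :
    Bornology.IsBounded A := by
  refine isBounded_of_forall_dual_bounded fun φ => ?_
  obtain ⟨C, hC⟩ := (hA.image φ.continuous_weakSpace).isBounded.exists_norm_le
  exact ⟨C, fun a ha => hC _ ⟨_, subset_closure ⟨a, ha, rfl⟩, rfl⟩⟩

theorem WeakTendsto.relativelyWeaklyCompact_range {x : ℕ → E} {a : E}
    (hx : WeakTendsto x atTop a) : RelativelyWeaklyCompact (Set.range x) := by
  have hK := Tendsto.isCompact_insert_range hx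
  refine hK.of_isClosed_subset isClosed_closure (closure_minimal ?_ hK.isClosed)
  rintro _ ⟨_, ⟨n, rfl⟩, rfl⟩
  exact Or.inr ⟨n, rfl⟩

theorem WeakTendsto.exists_norm_le {x : ℕ → E} {a : E} (hx : WeakTendsto x atTop a) :
    ∃ C, ∀ n, ‖x n‖ ≤ C := by
  obtain ⟨C, hC⟩ := hx.relativelyWeaklyCompact_range.isBounded.exists_norm_le
  exact ⟨C, fun n => hC _ ⟨n, rfl⟩⟩

/-! ### Sequences in relatively weakly compact sets. -/

/-- A point of the weak closure of a set is in the weak closure of a countable subset. -/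
theorem exists_countable_subset_of_weak_closure {B : Set E} {a : E}
    (ha : ∀ (n : ℕ) (φ : Fin n → StrongDual ℝ E), ∀ ε > 0, ∃ b ∈ B, ∀ i, |φ i (b - a)| < ε) :
    ∃ C ⊆ B, C.Countable ∧ ∀ (n : ℕ) (φ : Fin n → StrongDual ℝ E), (∀ i, ‖φ i‖ ≤ 1) →
      ∃ b ∈ C, ∀ i, |φ i (b - a)| < 1 / (n + 1) := by
  have key (n : ℕ) : ∃ t : Finset B, ∀ φ : Fin n → StrongDual ℝ E, (∀ i, ‖φ i‖ ≤ 1) →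
      ∃ b ∈ t, ∀ i, |φ i (b - a)| < 1 / (n + 1) := by
    -- By Banach-Alaoglu the `n`-tuples from the dual ball form a weak-* compact set, so finitely
    -- many `b` serve all tuples.
    have hK := isCompact_univ_pi fun _ : Fin n =>
      WeakDual.isCompact_closedBall (𝕜 := ℝ) (E := E) 0 1
    obtain ⟨t, ht⟩ := hK.elim_finite_subcover
      (fun b : B => {φ | ∀ i, |φ i (b - a)| < 1 / ((n : ℝ) + 1)})
      (fun b => by
        simp only [Set.ofPred_forall]
        refine isOpen_iInter_of_finite fun i => isOpen_lt ?_ continuous_const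
        exact ((WeakDual.eval_continuous _).comp (continuous_apply i)).abs)
      (fun φ _ => by
        obtain ⟨b, hb, h⟩ := ha n (fun i => WeakDual.toStrongDual (φ i)) (1 / (n + 1))
          (by positivity)
        exact Set.mem_iUnion.2 ⟨⟨b, hb⟩, h⟩)
    refine ⟨t, fun φ hφ => ?_⟩
    have := @ht (fun i => StrongDual.toWeakDual (φ i)) (fun i _ => by
      simpa using hφ i)
    simp only [Set.mem_iUnion] at this
    obtain ⟨b, hb, h⟩ := this
    exact ⟨b, hb, h⟩
  choose t ht using key
  refine ⟨⋃ n, (↑) '' (t n : Set B), ?_, ?_, fun n φ hφ => ?_⟩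
  · refine Set.iUnion_subset fun n => ?_
    rintro _ ⟨b, -, rfl⟩
    exact b.2
  · exact Set.countable_iUnion fun n => ((t n).countable_toSet.image _)
  · obtain ⟨b, hb, h⟩ := ht n φ hφ
    exact ⟨b, Set.mem_iUnion.2 ⟨n, b, hb, rfl⟩, h⟩

/-- A separable set is separated from `0` by countably many functionals of norm at most one. -/
theorem exists_seq_dual_separating {S : Set E} (hS : TopologicalSpace.IsSeparable S) :
    ∃ d : ℕ → StrongDual ℝ E, (∀ n, ‖d n‖ ≤ 1) ∧ ∀ z ∈ closure S, (∀ n, d n z = 0) → z = 0 := by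
  obtain ⟨c, hc, hSc⟩ := hS
  obtain ⟨e, he⟩ := (hc.insert (0 : E)).exists_eq_range (Set.insert_nonempty _ _)
  choose d hd hde using fun n => exists_dual_vector'' ℝ (e n)
  refine ⟨d, hd, fun z hz h => ?_⟩
  by_contra hz0
  have hz' : z ∈ closure (Set.range e) :=
    closure_minimal (hSc.trans (closure_mono (he ▸ Set.subset_insert _ _))) isClosed_closure hz
  obtain ⟨_, ⟨n, rfl⟩, hn⟩ := Metric.mem_closure_iff.1 hz' (‖z‖ / 2)
    (half_pos (norm_pos_iff.2 hz0))
  -- `d n` norms `e n` and kills `z`, so `‖e n‖ = d n (e n - z)`.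
  have h1 : ‖e n‖ ≤ ‖z - e n‖ := by
    have : ‖d n (z - e n)‖ ≤ 1 * ‖z - e n‖ := (d n).le_of_opNorm_le (hd n) _
    rw [map_sub, h n, hde n] at this
    simpa using this
  have h2 : ‖z‖ ≤ ‖z - e n‖ + ‖e n‖ := by simpa using norm_add_le (z - e n) (e n)
  rw [dist_eq_norm] at hn
  linarith

theorem mem_closure_submodule_of_mem_closure_weak {M : Submodule ℝ E} {z : E}
    (hz : toWeakSpace ℝ E z ∈ closure (toWeakSpace ℝ E '' (M : Set E))) :
    z ∈ closure (M : Set E) := by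
  rw [← Convex.toWeakSpace_closure ℝ M.convex] at hz
  obtain ⟨w, hw, h⟩ := hz
  rwa [← (toWeakSpace ℝ E).injective h]

/-- Relatively weakly compact sets have the Fréchet-Urysohn property. -/
theorem RelativelyWeaklyCompact.exists_seq_weakTendsto {A B : Set E}
    (hA : RelativelyWeaklyCompact A) (hB : B ⊆ A) {a : E}
    (ha : toWeakSpace ℝ E a ∈ closure (toWeakSpace ℝ E '' B)) :
    ∃ b : ℕ → E, (∀ n, b n ∈ B) ∧ WeakTendsto b atTop a := by
  obtain ⟨C, hCB, hC, h⟩ := exists_countable_subset_of_weak_closure (B := B) (a := a) <| by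
    intro n φ ε hε
    have hU : {x : WeakSpace ℝ E | ∀ i, |φ i ((toWeakSpace ℝ E).symm x - a)| < ε} ∈
        𝓝 (toWeakSpace ℝ E a) := by
      refine IsOpen.mem_nhds ?_ (by simp [hε])
      simp only [Set.ofPred_forall, map_sub]
      exact isOpen_iInter_of_finite fun i =>
        isOpen_lt ((φ i).continuous_weakSpace.sub continuous_const).abs continuous_const
    obtain ⟨_, hx, b, hb, rfl⟩ := mem_closure_iff_nhds.1 ha _ hU
    exact ⟨b, hb, fun i => by simpa using hx i⟩
  obtain ⟨d, hd, hsep⟩ := exists_seq_dual_separating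
    (TopologicalSpace.IsSeparable.span (R := ℝ) (hC.image fun c => c - a).isSeparable)
  -- `b n` is close to `a` on `d 0, …, d (n - 1)`. Thus every `d k` vanishes on `z - a` for each
  -- weak cluster point `z`; as `z - a` lies in the closed span of `C - a`, it is 0.
  choose b hbC hb using fun n : ℕ => h n (fun i => d i) fun i => hd i
  refine ⟨b, fun n => hCB (hbC n), hA.tendsto_nhds_of_unique_mapClusterPt
    (Eventually.of_forall fun n => subset_closure ⟨_, hB (hCB (hbC n)), rfl⟩) fun y _ hy => ?_⟩
  set z := (toWeakSpace ℝ E).symm y with hz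
  suffices z - a = 0 by
    rw [sub_eq_zero] at this
    rw [← this, hz, LinearEquiv.apply_symm_apply]
  have hy' : MapClusterPt (toWeakSpace ℝ E (z - a)) atTop fun n => toWeakSpace ℝ E (b n - a) := by
    have hc : Continuous fun w : WeakSpace ℝ E => w - toWeakSpace ℝ E a :=
      continuous_id.sub continuous_const
    have := hy.tendsto_comp (hc.tendsto y)
    simpa [hz, Function.comp_def] using this
  refine hsep _ (mem_closure_submodule_of_mem_closure_weak ?_) fun k => ?_
  · refine mem_closure_iff_nhds.2 fun U hU => ?_
    obtain ⟨n, hn⟩ := (mapClusterPt_iff_frequently.1 hy' U hU).exists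
    exact ⟨_, hn, _, Submodule.subset_span ⟨_, hbC n, rfl⟩, rfl⟩
  · have h0 : Tendsto (fun n => d k (b n - a)) atTop (𝓝 0) := by
      refine squeeze_zero_norm' ?_ tendsto_one_div_add_atTop_nhds_zero_nat
      filter_upwards [eventually_gt_atTop k] with n hn
      exact (hb n ⟨k, hn⟩).le
    have h1 := hy'.tendsto_comp ((d k).continuous_weakSpace.tendsto _)
    simp only [LinearEquiv.symm_apply_apply, Function.comp_def] at h1
    have : MapClusterPt (d k (z - a)) atTop fun n => d k (b n - a) := h1
    exact eq_of_nhds_neBot (ClusterPt.mono this h0)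

/-- A weakly sequentially continuous map is weakly continuous on relatively weakly compact sets. -/
theorem RelativelyWeaklyCompact.weakTendsto_comp {F : Type*} [NormedAddCommGroup F]
    [NormedSpace ℝ F] {A : Set E} (hA : RelativelyWeaklyCompact A) {g : E → F} {a : E}
    (hg : ∀ x : ℕ → E, WeakTendsto x atTop a → WeakTendsto (fun n => g (x n)) atTop (g a))
    {l : Filter ι} {x : ι → E} (hxA : ∀ i, x i ∈ A) (hx : WeakTendsto x l a) :
    WeakTendsto (fun i => g (x i)) l (g a) := by
  rw [weakTendsto_iff]
  intro φ
  by_contra hcon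
  rw [Metric.tendsto_nhds] at hcon
  push Not at hcon
  obtain ⟨ε, hε, hfr⟩ := hcon
  -- The bad points accumulate weakly at `a`, so a sequence of them converges to `a`, against `hg`.
  have ha : toWeakSpace ℝ E a ∈
      closure (toWeakSpace ℝ E '' (x '' {i | ε ≤ dist (φ (g (x i))) (φ (g a))})) := by
    refine mem_closure_iff_nhds.2 fun U hU => ?_
    obtain ⟨i, hi, hiU⟩ := (hfr.and_eventually (hx hU)).exists
    exact ⟨_, hiU, _, ⟨i, hi, rfl⟩, rfl⟩
  obtain ⟨b, hb, hba⟩ := hA.exists_seq_weakTendsto (by rintro _ ⟨i, -, rfl⟩; exact hxA i) ha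
  obtain ⟨n, hn⟩ := (Metric.tendsto_nhds.1 (weakTendsto_iff.1 (hg b hba) φ) ε hε).exists
  obtain ⟨i, hi, hin⟩ := hb n
  rw [← hin] at hn
  exact absurd hn (not_lt.2 hi)

/-! ### Uniform tails, as in the Schur property of ℓ¹. -/

/-- If `∑ |h k x| ≤ C * ‖x‖`, then `h k → 0` uniformly on weakly convergent sequences. -/
theorem WeakTendsto.eventually_dual_le {h : ℕ → StrongDual ℝ E} {C : ℝ}
    (hC : ∀ x n, ∑ k ∈ Finset.range n, |h k x| ≤ C * ‖x‖) {y : ℕ → E} {b : E}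
    (hy : WeakTendsto y atTop b) {ε : ℝ} (hε : 0 < ε) :
    ∃ K, ∀ k ≥ K, ∀ n, |h k (y n)| ≤ ε := by
  have hsum (x : E) : Summable fun k => |h k x| :=
    summable_of_sum_range_le (fun _ => abs_nonneg _) (hC x)
  have hle (s : ℕ → Bool) (k : ℕ) (x : E) : ‖if s k then h k x else 0‖ ≤ |h k x| := by
    split_ifs <;> simp
  have hsum' (s : ℕ → Bool) (x : E) : Summable fun k => if s k then h k x else 0 :=
    Summable.of_norm_bounded (hsum x) fun k => hle s k x
  let T (s : ℕ → Bool) : StrongDual ℝ E := LinearMap.mkContinuous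
    { toFun := fun x => ∑' k, if s k then h k x else 0
      map_add' := fun x x' => by
        rw [← (hsum' s x).tsum_add (hsum' s x')]
        exact tsum_congr fun k => by split_ifs <;> simp
      map_smul' := fun c x => by
        simp only [RingHom.id_apply, smul_eq_mul]
        rw [← tsum_mul_left]
        exact tsum_congr fun k => by split_ifs <;> simp } C fun x =>
      (tsum_of_norm_bounded (hsum x).hasSum fun k => hle s k x).trans
        ((hsum x).tsum_le_of_sum_range_le (hC x))
  have hT (s : ℕ → Bool) (x : E) : T s x = ∑' k, if s k then h k x else 0 := rfl
  have hTcont (x : E) : Continuous fun s => T s x := by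
    refine continuous_tsum (fun k => ?_) (hsum x) fun k s => hle s k x
    exact (continuous_of_discreteTopology (f := fun t : Bool => if t then h k x else 0)).comp
      (continuous_apply k)
  -- Baire category on the Cantor space of sub-sums: some `F N` has an interior point `s`. Changing
  -- coordinate `k` of `s` stays in `F N` for large `k`, and the difference of the two sub-sums is
  -- `h k`.
  let F (N : ℕ) : Set (ℕ → Bool) := {s | ∀ n ≥ N, |T s (y n - b)| ≤ ε / 4}
  have hF (N : ℕ) : IsClosed (F N) := by
    simp only [F, Set.ofPred_forall]
    exact isClosed_iInter fun n => isClosed_iInter fun _ =>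
      isClosed_le (hTcont _).abs continuous_const
  have hy0 : WeakTendsto (fun n => y n - b) atTop 0 := by
    simpa using hy.sub (WeakTendsto.const atTop b)
  have hU : ⋃ N, F N = Set.univ := by
    refine Set.eq_univ_of_forall fun s => Set.mem_iUnion.2 ?_
    have := weakTendsto_iff.1 hy0 (T s)
    rw [map_zero, Metric.tendsto_atTop] at this
    obtain ⟨N, hN⟩ := this (ε / 4) (by positivity)
    exact ⟨N, fun n hn => by simpa using (hN n hn).le⟩
  obtain ⟨N, s, hs⟩ := nonempty_interior_of_iUnion_of_closed hF hU
  have hlim (t : Bool) : Tendsto (fun k => Function.update s k t) atTop (𝓝 s) := by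
    refine tendsto_pi_nhds.2 fun i => tendsto_const_nhds.congr' ?_
    filter_upwards [eventually_gt_atTop i] with k hk
    rw [Function.update_of_ne hk.ne]
  have hev (t : Bool) : ∀ᶠ k in atTop, Function.update s k t ∈ F N :=
    (hlim t).eventually (mem_interior_iff_mem_nhds.1 hs)
  have hdiff (k : ℕ) (x : E) :
      h k x = T (Function.update s k true) x - T (Function.update s k false) x := by
    rw [hT, hT, ← (hsum' _ x).tsum_sub (hsum' _ x), tsum_eq_single k]
    · simp
    · intro j hj
      simp [Function.update_of_ne hj]
  have hpt (x : E) : ∀ᶠ k in atTop, |h k x| ≤ ε / 2 := by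
    filter_upwards [Metric.tendsto_nhds.1 (hsum x).tendsto_atTop_zero (ε / 2) (by positivity)]
      with k hk
    simpa using hk.le
  have hfin : ∀ᶠ k in atTop, ∀ n ∈ Finset.range N, |h k (y n)| ≤ ε / 2 :=
    (Finset.eventually_all _).2 fun n _ => hpt (y n)
  rw [← eventually_atTop]
  filter_upwards [hev true, hev false, hpt b, hfin] with k h1 h2 h3 h4 n
  rcases lt_or_ge n N with hn | hn
  · exact (h4 n (Finset.mem_range.2 hn)).trans (by linarith)
  · have e : h k (y n) = h k (y n - b) + h k b := by simp
    have h5 := abs_sub (T (Function.update s k true) (y n - b))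
      (T (Function.update s k false) (y n - b))
    have h6 := abs_add_le (h k (y n - b)) (h k b)
    rw [← hdiff] at h5
    rw [e]
    linarith [h1 n hn, h2 n hn]

end WeakTopology

/-! ### Nets from filters. -/

/-- Every proper filter is the image of the order filter of a directed set. -/
theorem Filter.exists_directed_tendsto {ι : Type u} (F : Filter ι) [F.NeBot] :
    ∃ (κ : Type u) (_ : Preorder κ) (_ : IsDirectedOrder κ) (_ : Nonempty κ) (φ : κ → ι),
      Tendsto φ atTop F := by
  let κ := {p : ι × F.sets // p.1 ∈ p.2.1}
  let P : Preorder κ := Preorder.lift fun p => OrderDual.toDual p.1.2.1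
  have hle (p q : κ) : p ≤ q ↔ q.1.2.1 ⊆ p.1.2.1 := Iff.rfl
  have hmk (s : Set ι) (hs : s ∈ F) : ∃ p : κ, p.1.2.1 = s := by
    obtain ⟨i, hi⟩ := F.nonempty_of_mem hs
    exact ⟨⟨(i, ⟨s, hs⟩), hi⟩, rfl⟩
  have hne : Nonempty κ := ⟨(hmk _ univ_mem).choose⟩
  have hdir : IsDirectedOrder κ := ⟨fun p q => by
    obtain ⟨r, hr⟩ := hmk _ (inter_mem p.1.2.2 q.1.2.2)
    exact ⟨r, by rw [hle, hr]; exact Set.inter_subset_left,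
      by rw [hle, hr]; exact Set.inter_subset_right⟩⟩
  refine ⟨κ, P, hdir, hne, fun p => p.1.1, fun s hs => ?_⟩
  obtain ⟨p, hp⟩ := hmk s hs
  refine mem_map.2 (mem_of_superset (Ici_mem_atTop p) fun q hq => ?_)
  rw [Set.mem_Ici, hle, hp] at hq
  exact hq q.2

/-! ### Vector lattice inequalities. -/

section VectorLattice

variable {E : Type*} [AddCommGroup E] [Lattice E] [IsOrderedAddMonoid E]

theorem add_inf_le_inf_add_inf {a b c : E} (ha : 0 ≤ a) (hb : 0 ≤ b) (hc : 0 ≤ c) :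
    (a + b) ⊓ c ≤ a ⊓ c + b ⊓ c := by
  rw [add_inf, inf_add, inf_add]
  refine le_inf (le_inf inf_le_left ?_) (le_inf ?_ ?_)
  · exact inf_le_right.trans (le_add_of_nonneg_right hb)
  · exact inf_le_right.trans (le_add_of_nonneg_left ha)
  · exact inf_le_right.trans (le_add_of_nonneg_left hc)

/-- Riesz decomposition: truncate `z` to the interval from `-x` to `x`; the remainder has modulus at
most `y`. -/
theorem exists_abs_le_add_eq_of_abs_le_add {x y z : E} (hx : 0 ≤ x) (hy : 0 ≤ y)
    (hz : |z| ≤ x + y) : ∃ z₁ z₂, |z₁| ≤ x ∧ |z₂| ≤ y ∧ z₁ + z₂ = z := by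
  obtain ⟨h1, h2⟩ := abs_le'.1 hz
  refine ⟨(z ⊓ x) ⊔ -x, z - ((z ⊓ x) ⊔ -x), abs_le'.2 ⟨?_, ?_⟩, abs_le'.2 ⟨?_, ?_⟩, by abel⟩
  · exact sup_le inf_le_right ((neg_nonpos.2 hx).trans hx)
  · exact neg_le.1 le_sup_right
  · rw [sub_le_iff_le_add, add_sup, add_inf]
    refine le_sup_of_le_left (le_inf (le_add_of_nonneg_left hy) ?_)
    rwa [add_comm]
  · rw [neg_sub, sub_le_iff_le_add]
    refine sup_le (inf_le_left.trans (le_add_of_nonneg_left hy)) ?_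
    rw [neg_le_iff_add_nonneg] at h2 ⊢
    convert h2 using 1
    abel

/-- Partial sums stay disjoint from further terms, and `a ⊓ b + a ⊔ b = a + b` then turns sums into
suprema. -/
theorem Finset.sum_le_of_pairwise_inf_eq_zero {ι : Type*} [DecidableEq ι] {w : ι → E} {x : E}
    (hx : 0 ≤ x) (hw : ∀ i, 0 ≤ w i) (hwx : ∀ i, w i ≤ x)
    (hdisj : Pairwise fun i j => w i ⊓ w j = 0) (s : Finset ι) : ∑ i ∈ s, w i ≤ x := by
  have hinf (s : Finset ι) : ∀ j ∉ s, (∑ i ∈ s, w i) ⊓ w j = 0 := by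
    induction s using Finset.induction_on with
    | empty => intro j _; simpa using hw j
    | insert i s hi ih =>
      intro j hj
      rw [Finset.mem_insert, not_or] at hj
      rw [Finset.sum_insert hi]
      refine le_antisymm ?_ (le_inf (add_nonneg (hw i) (Finset.sum_nonneg fun k _ => hw k)) (hw j))
      refine (add_inf_le_inf_add_inf (hw i) (Finset.sum_nonneg fun k _ => hw k) (hw j)).trans ?_
      rw [hdisj (Ne.symm hj.1), ih j hj.2, add_zero]
  induction s using Finset.induction_on with
  | empty => simpa
  | insert i s hi ih =>
    rw [Finset.sum_insert hi, ← inf_add_sup, inf_comm, hinf s i hi, zero_add]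
    exact sup_le (hwx i) ih

theorem abs_inf_sub_inf_le_add (a b c d : E) : |a ⊓ c - b ⊓ d| ≤ |a - b| + |c - d| := by
  have h1 := abs_inf_sub_inf_le_abs a b c
  have h2 := abs_inf_sub_inf_le_abs c d b
  rw [inf_comm c, inf_comm d] at h2
  calc |a ⊓ c - b ⊓ d| = |(a ⊓ c - b ⊓ c) + (b ⊓ c - b ⊓ d)| := by congr 1; abel
    _ ≤ _ := (abs_add_le _ _).trans (add_le_add h1 h2)

theorem abs_sup_sub_sup_le_add (a b c d : E) : |a ⊔ c - b ⊔ d| ≤ |a - b| + |c - d| := by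
  have h1 := abs_sup_sub_sup_le_abs a b c
  have h2 := abs_sup_sub_sup_le_abs c d b
  rw [sup_comm c, sup_comm d] at h2
  calc |a ⊔ c - b ⊔ d| = |(a ⊔ c - b ⊔ c) + (b ⊔ c - b ⊔ d)| := by congr 1; abel
    _ ≤ _ := (abs_add_le _ _).trans (add_le_add h1 h2)

section Module

variable {E : Type*} [AddCommGroup E] [Lattice E] [Module ℝ E] [IsOrderedModule ℝ E]

theorem smul_inf_of_pos {c : ℝ} (hc : 0 < c) (a b : E) : c • (a ⊓ b) = c • a ⊓ c • b :=
  (OrderIso.smulRight hc).map_inf a b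

theorem smul_sup_of_pos {c : ℝ} (hc : 0 < c) (a b : E) : c • (a ⊔ b) = c • a ⊔ c • b :=
  (OrderIso.smulRight hc).map_sup a b

theorem abs_smul_of_pos {c : ℝ} (hc : 0 < c) (a : E) : |c • a| = c • |a| := by
  rw [abs, abs, smul_sup_of_pos hc, smul_neg]

variable [IsOrderedAddMonoid E]

/-- The positive parts of `x - c • y` and `y - d • x` are disjoint if `1 ≤ c * d`. -/
theorem posPart_sub_smul_inf_posPart_sub_smul {x y : E} {c d : ℝ} (hd : 0 < d) (hd1 : d ≤ 1)
    (hcd : 1 ≤ c * d) (hy : 0 ≤ y) : (x - c • y)⁺ ⊓ (y - d • x)⁺ = 0 := by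
  refine le_antisymm ?_ (le_inf (posPart_nonneg _) (posPart_nonneg _))
  rw [← posPart_inf_negPart_eq_zero (x - c • y)]
  refine le_inf inf_le_left (inf_le_right.trans ?_)
  -- Here `1 ≤ c * d` gives `y - d • x ≤ d • (c • y - x)`.
  have h1 : (y - d • x)⁺ ≤ d • (x - c • y)⁻ := by
    rw [negPart_def, posPart_def, smul_sup_of_pos hd, smul_zero, neg_sub, smul_sub, smul_smul]
    refine sup_le_sup_right (sub_le_sub_right ?_ _) _
    rw [mul_comm]
    exact le_smul_of_one_le_left hy hcd
  exact h1.trans (smul_le_of_le_one_left (negPart_nonneg _) hd1)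

end Module

end VectorLattice

/-! ### Positive functionals and their components. -/

section BanachLattice

variable {E : Type*} [NormedAddCommGroup E] [NormedSpace ℝ E] [Lattice E]
  [IsOrderedAddMonoid E]

theorem StrongDual.mono_of_nonneg {f : StrongDual ℝ E} (hf : ∀ x, 0 ≤ x → 0 ≤ f x) {x y : E}
    (h : x ≤ y) : f x ≤ f y := by
  have := hf _ (sub_nonneg.2 h)
  rwa [map_sub, sub_nonneg] at this

/-- For fixed `j` the truncations are disjoint and below `|x|`, hence so is their sum; then let `j →
∞`. -/
theorem StrongDual.sum_iSup_inf_le [IsOrderedModule ℝ E] {f : StrongDual ℝ E}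
    (hf : ∀ x, 0 ≤ x → 0 ≤ f x)
    {v : ℕ → E} (hv : ∀ k, 0 ≤ v k) (hdisj : Pairwise fun i j => v i ⊓ v j = 0) (x : E) (n : ℕ) :
    ∑ k ∈ Finset.range n, (⨆ j : ℕ, f (|x| ⊓ ((j : ℝ) + 1) • v k)) ≤ f |x| := by
  have hlim (k : ℕ) : Tendsto (fun j : ℕ => f (|x| ⊓ ((j : ℝ) + 1) • v k)) atTop
      (𝓝 (⨆ j : ℕ, f (|x| ⊓ ((j : ℝ) + 1) • v k))) := by
    refine tendsto_atTop_ciSup (fun i j hij => ?_)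
      ⟨f |x|, by rintro _ ⟨j, rfl⟩; exact mono_of_nonneg hf inf_le_left⟩
    refine mono_of_nonneg hf (inf_le_inf_left _ (smul_le_smul_of_nonneg_right ?_ (hv k)))
    gcongr
  refine le_of_tendsto (tendsto_finsetSum _ fun k _ => hlim k) (Eventually.of_forall fun j => ?_)
  rw [← map_sum]
  have hj : (0 : ℝ) < (j : ℝ) + 1 := by positivity
  have hnn (k : ℕ) : 0 ≤ |x| ⊓ ((j : ℝ) + 1) • v k :=
    le_inf (abs_nonneg x) (smul_nonneg hj.le (hv k))
  refine mono_of_nonneg hf (Finset.sum_le_of_pairwise_inf_eq_zero (abs_nonneg x) hnn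
    (fun k => inf_le_left) (fun i k hik => ?_) _)
  refine le_antisymm ?_ (le_inf (hnn i) (hnn k))
  refine (inf_le_inf inf_le_right inf_le_right).trans ?_
  rw [← smul_inf_of_pos hj, hdisj hik, smul_zero]

variable [HasSolidNorm E]

theorem StrongDual.apply_abs_le (f : StrongDual ℝ E) (x : E) : f |x| ≤ ‖f‖ * ‖x‖ := by
  have := (le_abs_self _).trans (f.le_opNorm |x|)
  rwa [norm_abs_eq_norm] at this

/-- Every continuous functional is dominated by a positive one. -/
theorem StrongDual.exists_nonneg_dominating (φ : StrongDual ℝ E) :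
    ∃ f : StrongDual ℝ E, (∀ x, 0 ≤ x → 0 ≤ f x) ∧ ∀ x, |φ x| ≤ f |x| := by
  -- On the positive cone `q` is the modulus of `φ`, additive by Riesz decomposition.
  let q (x : E) : ℝ := sSup (φ '' {y | |y| ≤ x})
  have hub (x y : E) (h : |y| ≤ x) : φ y ≤ ‖φ‖ * ‖x‖ := by
    refine (le_abs_self _).trans ((φ.le_opNorm y).trans ?_)
    exact mul_le_mul_of_nonneg_left (norm_le_norm_of_abs_le_abs (h.trans (le_abs_self x)))
      (norm_nonneg _)
  have hbdd (x : E) : BddAbove (φ '' {y | |y| ≤ x}) :=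
    ⟨‖φ‖ * ‖x‖, by rintro _ ⟨y, hy, rfl⟩; exact hub x y hy⟩
  have hne {x : E} (hx : 0 ≤ x) : (φ '' {y | |y| ≤ x}).Nonempty := ⟨φ 0, 0, by simpa, rfl⟩
  have hle (x y : E) (h : |y| ≤ x) : φ y ≤ q x := le_csSup (hbdd x) ⟨y, h, rfl⟩
  have hq0 {x : E} (hx : 0 ≤ x) : 0 ≤ q x := by simpa using hle x 0 (by simpa)
  have hqn {x : E} (hx : 0 ≤ x) : q x ≤ ‖φ‖ * ‖x‖ :=
    csSup_le (hne hx) (by rintro _ ⟨y, hy, rfl⟩; exact hub x y hy)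
  have hadd {x y : E} (hx : 0 ≤ x) (hy : 0 ≤ y) : q (x + y) = q x + q y := by
    refine le_antisymm (csSup_le (hne (add_nonneg hx hy)) ?_) ?_
    · rintro _ ⟨z, hz, rfl⟩
      obtain ⟨z₁, z₂, h1, h2, rfl⟩ := exists_abs_le_add_eq_of_abs_le_add hx hy hz
      rw [map_add]
      exact add_le_add (hle _ _ h1) (hle _ _ h2)
    · rw [← le_sub_iff_add_le]
      refine csSup_le (hne hx) ?_
      rintro _ ⟨z₁, h1, rfl⟩
      rw [le_sub_iff_add_le, ← le_sub_iff_add_le']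
      refine csSup_le (hne hy) ?_
      rintro _ ⟨z₂, h2, rfl⟩
      rw [le_sub_iff_add_le', ← map_add]
      exact hle _ _ ((abs_add_le _ _).trans (add_le_add h1 h2))
  let g : E →+ ℝ := AddMonoidHom.mk' (fun x => q x⁺ - q x⁻) fun x y => by
    have h : (x + y)⁺ + (x⁻ + y⁻) = x⁺ + y⁺ + (x + y)⁻ := by
      have h1 := posPart_sub_negPart (x + y)
      have h2 := posPart_sub_negPart x
      have h3 := posPart_sub_negPart y
      rw [sub_eq_iff_eq_add] at h1 h2 h3
      rw [h1, h2, h3]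
      abel
    have h' := congrArg q h
    rw [hadd (posPart_nonneg _) (add_nonneg (negPart_nonneg _) (negPart_nonneg _)),
      hadd (negPart_nonneg _) (negPart_nonneg _),
      hadd (add_nonneg (posPart_nonneg _) (posPart_nonneg _)) (negPart_nonneg _),
      hadd (posPart_nonneg _) (posPart_nonneg _)] at h'
    linarith
  have hg (x : E) : g x = q x⁺ - q x⁻ := rfl
  have hgq {x : E} (hx : 0 ≤ x) : g x = q x := by
    have h0 : q 0 = 0 := by simpa using hadd (le_refl (0 : E)) le_rfl
    rw [hg, posPart_of_nonneg hx, negPart_of_nonneg hx, h0, sub_zero]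
  have hcont : Continuous g := by
    refine AddMonoidHomClass.continuous_of_bound g ‖φ‖ fun x => ?_
    have h : q x⁺ + q x⁻ ≤ ‖φ‖ * ‖x‖ := by
      rw [← hadd (posPart_nonneg _) (negPart_nonneg _), posPart_add_negPart, ← norm_abs_eq_norm x]
      exact hqn (abs_nonneg x)
    rw [hg, Real.norm_eq_abs]
    have h1 := hq0 (posPart_nonneg x)
    have h2 := hq0 (negPart_nonneg x)
    exact abs_le.2 ⟨by linarith, by linarith⟩
  refine ⟨g.toRealLinearMap hcont, fun x hx => ?_, fun x => ?_⟩
  · exact (hq0 hx).trans_eq (hgq hx).symm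
  · refine le_trans ?_ (hgq (abs_nonneg x)).ge
    exact abs_le'.2 ⟨hle _ _ le_rfl, by rw [← map_neg]; exact hle _ _ (abs_neg x).le⟩

theorem weakTendsto_of_forall_nonneg {ι : Type*} {x : ι → E} {l : Filter ι} {a : E}
    (h : ∀ f : StrongDual ℝ E, (∀ x, 0 ≤ x → 0 ≤ f x) →
      Tendsto (fun i => f |x i - a|) l (𝓝 0)) : WeakTendsto x l a := by
  refine weakTendsto_iff.2 fun φ => tendsto_sub_nhds_zero_iff.1 ?_
  obtain ⟨f, hf, hφ⟩ := φ.exists_nonneg_dominating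
  exact squeeze_zero_norm (fun i => by simpa using hφ (x i - a)) (h f hf)

variable [IsOrderedModule ℝ E]

/-- The component of a positive functional along `v ≥ 0` attains its value at `|y|` by a
functional it dominates. -/
theorem StrongDual.exists_dominated_component {f : StrongDual ℝ E} (hf : ∀ x, 0 ≤ x → 0 ≤ f x)
    {v : E} (hv : 0 ≤ v) (y : E) (hvy : v ≤ |y|) :
    ∃ h : StrongDual ℝ E, f v ≤ h y ∧
      ∀ x, |h x| ≤ ⨆ j : ℕ, f (|x| ⊓ ((j : ℝ) + 1) • v) := by
  let p (x : E) : ℝ := ⨆ j : ℕ, f (|x| ⊓ ((j : ℝ) + 1) • v)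
  have hnn (j : ℕ) : 0 ≤ ((j : ℝ) + 1) • v := smul_nonneg (by positivity) hv
  have hbdd (x : E) : BddAbove (Set.range fun j : ℕ => f (|x| ⊓ ((j : ℝ) + 1) • v)) :=
    ⟨f |x|, by rintro _ ⟨j, rfl⟩; exact mono_of_nonneg hf inf_le_left⟩
  have hpf (x : E) : p x ≤ f |x| := ciSup_le fun j => mono_of_nonneg hf inf_le_left
  have hp0 (x : E) : 0 ≤ p x :=
    Real.iSup_nonneg fun j => hf _ (le_inf (abs_nonneg x) (hnn j))
  have hpneg (x : E) : p (-x) = p x := by simp only [p, abs_neg]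
  have hpadd (x x' : E) : p (x + x') ≤ p x + p x' := by
    refine ciSup_le fun j => ?_
    refine le_trans ?_ (add_le_add (le_ciSup (hbdd x) j) (le_ciSup (hbdd x') j))
    rw [← map_add]
    refine mono_of_nonneg hf ((inf_le_inf_right _ (abs_add_le x x')).trans ?_)
    exact add_inf_le_inf_add_inf (abs_nonneg x) (abs_nonneg x') (hnn j)
  have hpsmul' (c : ℝ) (hc : 0 < c) (x : E) : p (c • x) ≤ c * p x := by
    refine ciSup_le fun j => ?_
    -- Homogeneity holds only after the supremum: a larger index `m` absorbs the factor `c`.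
    obtain ⟨m, hm⟩ := exists_nat_ge (((j : ℝ) + 1) / c)
    have hm' : ((j : ℝ) + 1) ≤ c * ((m : ℝ) + 1) := by
      rw [div_le_iff₀ hc] at hm
      linarith
    refine le_trans ?_ (mul_le_mul_of_nonneg_left (le_ciSup (hbdd x) m) hc.le)
    rw [← smul_eq_mul, ← map_smul]
    refine mono_of_nonneg hf ?_
    rw [smul_inf_of_pos hc, abs_smul_of_pos hc, smul_smul]
    exact inf_le_inf_left _ (smul_le_smul_of_nonneg_right hm' hv)
  have hpsmul (c : ℝ) (hc : 0 < c) (x : E) : p (c • x) = c * p x := by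
    refine le_antisymm (hpsmul' c hc x) ?_
    have := hpsmul' c⁻¹ (inv_pos.2 hc) (c • x)
    rwa [inv_smul_smul₀ hc.ne', ← div_eq_inv_mul, le_div_iff₀' hc] at this
  have hvp : f v ≤ p y := by
    have := le_ciSup (hbdd y) 0
    simpa [inf_eq_right.2 hvy] using this
  -- Hahn-Banach from the line through `y`, dominated by the seminorm `p`.
  obtain ⟨g, hgy, hgp⟩ : ∃ g : E →ₗ[ℝ] ℝ, g y = p y ∧ ∀ x, g x ≤ p x := by
    rcases eq_or_ne y 0 with rfl | hy
    · refine ⟨0, le_antisymm (hp0 0) ((hpf 0).trans (by simp)), fun x => hp0 x⟩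
    · obtain ⟨g, h1, h2⟩ := exists_extension_of_le_sublinear
        (LinearPMap.mkSpanSingleton y (p y) hy) p hpsmul hpadd (by
          rintro ⟨x, hx⟩
          obtain ⟨c, rfl⟩ := Submodule.mem_span_singleton.1 hx
          rw [LinearPMap.mkSpanSingleton'_apply]
          simp only [RingHom.id_apply, smul_eq_mul]
          rcases lt_trichotomy c 0 with hc | rfl | hc
          · exact (mul_nonpos_of_nonpos_of_nonneg hc.le (hp0 y)).trans (hp0 _)
          · simpa using hp0 _
          · exact (hpsmul c hc y).ge)
      refine ⟨g, ?_, h2⟩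
      exact (h1 ⟨y, Submodule.mem_span_singleton_self y⟩).trans
        (LinearPMap.mkSpanSingleton_apply ℝ ℝ hy (p y))
  have hgabs (x : E) : |g x| ≤ p x :=
    abs_le'.2 ⟨hgp x, by rw [← map_neg, ← hpneg]; exact hgp (-x)⟩
  exact ⟨g.mkContinuous ‖f‖ fun x => (hgabs x).trans ((hpf x).trans (f.apply_abs_le x)),
    hvp.trans_eq hgy.symm, hgabs⟩

/-- A disjoint sequence in the solid hull of a weakly convergent sequence is weakly null. -/
theorem WeakTendsto.eventually_le_of_disjoint {y : ℕ → E} {b : E} (hy : WeakTendsto y atTop b)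
    {f : StrongDual ℝ E} (hf : ∀ x, 0 ≤ x → 0 ≤ f x) {v : ℕ → E} (hv : ∀ k, 0 ≤ v k)
    (hdisj : Pairwise fun i j => v i ⊓ v j = 0) {m : ℕ → ℕ} (hvy : ∀ k, v k ≤ |y (m k)|)
    {ε : ℝ} (hε : 0 < ε) : ∃ K, ∀ k ≥ K, f (v k) ≤ ε := by
  choose h hh hle using fun k => StrongDual.exists_dominated_component hf (hv k) (y (m k)) (hvy k)
  obtain ⟨K, hK⟩ := hy.eventually_dual_le (h := h) (C := ‖f‖) (fun x n =>
    (Finset.sum_le_sum fun k _ => hle k x).trans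
      ((StrongDual.sum_iSup_inf_le hf hv hdisj x n).trans (f.apply_abs_le x))) hε
  exact ⟨K, fun k hk => (hh k).trans ((le_abs_self _).trans (hK k hk (m k)))⟩

end BanachLattice

/-! ### Almost order boundedness of weakly convergent sequences. -/

section BanachLattice

variable {E : Type*} [NormedAddCommGroup E] [NormedSpace ℝ E] [Lattice E]
  [IsOrderedAddMonoid E] [HasSolidNorm E]

/-- Both operations change by at most `|x - a| + |y - b|`, so only moduli of weakly null sequences
matter. -/
theorem weaklySeqContinuousLatticeOps_of_abs
    (h : ∀ x : ℕ → E, WeakTendsto x atTop 0 → ∀ f : StrongDual ℝ E, (∀ x, 0 ≤ x → 0 ≤ f x) →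
      Tendsto (fun n => f |x n|) atTop (𝓝 0)) : WeaklySeqContinuousLatticeOps E := by
  intro x y a b hx hy
  have key {g : ℕ → E} {c : E} (hg : ∀ n, |g n - c| ≤ |x n - a| + |y n - b|) :
      WeakTendsto g atTop c := by
    refine weakTendsto_of_forall_nonneg fun f hf => ?_
    have hx' := h _ (by simpa using hx.sub (WeakTendsto.const atTop a)) f hf
    have hy' := h _ (by simpa using hy.sub (WeakTendsto.const atTop b)) f hf
    refine squeeze_zero (fun n => hf _ (abs_nonneg _)) (fun n => ?_) (by simpa using hx'.add hy')
    rw [← map_add]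
    exact StrongDual.mono_of_nonneg hf (hg n)
  exact ⟨key fun n => abs_sup_sub_sup_le_add _ _ _ _, key fun n => abs_inf_sub_inf_le_add _ _ _ _⟩

variable [IsOrderedModule ℝ E]

/-- A weakly convergent sequence is almost order bounded with respect to each positive
functional. -/
theorem WeakTendsto.exists_posPart_abs_sub_le [CompleteSpace E] {y : ℕ → E} {b : E}
    (hy : WeakTendsto y atTop b) {f : StrongDual ℝ E} (hf : ∀ x, 0 ≤ x → 0 ≤ f x) {ε : ℝ}
    (hε : 0 < ε) : ∃ u, 0 ≤ u ∧ ∀ n, f (|y n| - u)⁺ ≤ ε := by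
  by_contra! hcon
  choose! c hc using hcon
  -- `m k` is an index violating the bound for `u = 4 ^ k • S k`, where `S k` sums the earlier `|y
  -- (m i)|`.
  let S : ℕ → E := fun k => Nat.rec 0 (fun k s => s + |y (c ((4 : ℝ) ^ k • s))|) k
  let m (k : ℕ) : ℕ := c ((4 : ℝ) ^ k • S k)
  have hSsucc (k : ℕ) : S (k + 1) = S k + |y (m k)| := rfl
  have hSmono : Monotone S := monotone_nat_of_le_succ fun k => by
    rw [hSsucc]
    exact le_add_of_nonneg_right (abs_nonneg _)
  have hS0 (k : ℕ) : 0 ≤ S k := hSmono (Nat.zero_le k)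
  have hzS {i k : ℕ} (h : i < k) : |y (m i)| ≤ S k := by
    refine le_trans ?_ (hSmono h)
    rw [Nat.succ_eq_add_one, hSsucc]
    exact le_add_of_nonneg_left (hS0 i)
  have h4S (k : ℕ) : 0 ≤ (4 : ℝ) ^ k • S k := smul_nonneg (by positivity) (hS0 k)
  obtain ⟨C, hC⟩ := hy.exists_norm_le
  have hsum : Summable fun k => ((1 : ℝ) / 2) ^ k • |y (m k)| := by
    refine Summable.of_norm_bounded (summable_geometric_two.mul_right C) fun k => ?_
    rw [norm_smul, norm_abs_eq_norm, norm_pow, Real.norm_of_nonneg (by norm_num)]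
    exact mul_le_mul_of_nonneg_left (hC _) (by positivity)
  let Y : E := ∑' k, ((1 : ℝ) / 2) ^ k • |y (m k)|
  have hnn (k : ℕ) : 0 ≤ ((1 : ℝ) / 2) ^ k • |y (m k)| :=
    smul_nonneg (by positivity) (abs_nonneg _)
  have hzY (k : ℕ) : ((1 : ℝ) / 2) ^ k • |y (m k)| ≤ Y := hsum.le_tsum k fun j _ => hnn j
  have hY0 : 0 ≤ Y := (hnn 0).trans (hzY 0)
  have hY (k : ℕ) : 0 ≤ ((1 : ℝ) / 2) ^ k • Y := smul_nonneg (by positivity) hY0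
  -- The term in `S k` gives disjointness from earlier `v i`, the term in `Y` from later ones: for
  -- `i < k` the factors `4 ^ k` and `(1 / 2) ^ (i + k)` have product at least 1. The `Y` term costs
  -- only `(1 / 2) ^ k * f Y`.
  let v (k : ℕ) : E := (|y (m k)| - (4 : ℝ) ^ k • S k - ((1 : ℝ) / 2) ^ k • Y)⁺
  have hvz (k : ℕ) : v k ≤ |y (m k)| := by
    refine sup_le ?_ (abs_nonneg _)
    rw [sub_sub]
    exact sub_le_self _ (add_nonneg (h4S k) (hY k))
  have hlt {i k : ℕ} (h : i < k) : v k ⊓ v i = 0 := by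
    refine le_antisymm ?_ (le_inf (posPart_nonneg _) (posPart_nonneg _))
    rw [← posPart_sub_smul_inf_posPart_sub_smul (x := |y (m k)|) (y := |y (m i)|)
      (c := 4 ^ k) (d := (1 / 2) ^ (i + k)) (by positivity)
      (pow_le_one₀ (by norm_num) (by norm_num)) ?_ (abs_nonneg _)]
    · refine inf_le_inf (posPart_mono ?_) (posPart_mono ?_)
      · refine (sub_le_self _ (hY k)).trans (sub_le_sub_left ?_ _)
        exact smul_le_smul_of_nonneg_left (hzS h) (by positivity)
      · refine sub_le_sub (sub_le_self _ (h4S i)) ?_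
        rw [pow_add, mul_smul]
        exact smul_le_smul_of_nonneg_left (hzY k) (by positivity)
    · calc (1 : ℝ) = 4 ^ k * (1 / 2) ^ (k + k) := by
            rw [← two_mul, pow_mul, ← mul_pow]; norm_num
        _ ≤ 4 ^ k * (1 / 2) ^ (i + k) := by
            refine mul_le_mul_of_nonneg_left ?_ (by positivity)
            exact pow_le_pow_of_le_one (by norm_num) (by norm_num) (by omega)
  have hdisj : Pairwise fun i j => v i ⊓ v j = 0 := fun i j hij => by
    rcases hij.lt_or_gt with h | h
    · rw [inf_comm]; exact hlt h
    · exact hlt h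
  obtain ⟨K, hK⟩ := hy.eventually_le_of_disjoint hf (v := v) (fun k => posPart_nonneg _) hdisj hvz
    (half_pos hε)
  have hlim : Tendsto (fun k : ℕ => ((1 : ℝ) / 2) ^ k * f Y) atTop (𝓝 0) := by
    simpa using (tendsto_pow_atTop_nhds_zero_of_lt_one (r := (1 : ℝ) / 2) (by norm_num)
      (by norm_num)).mul_const (f Y)
  obtain ⟨k, hkK, hk⟩ := ((eventually_ge_atTop K).and
    (hlim.eventually (gt_mem_nhds (half_pos hε)))).exists
  have h1 : ε < f (|y (m k)| - (4 : ℝ) ^ k • S k)⁺ := hc _ (h4S k)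
  have h2 : (|y (m k)| - (4 : ℝ) ^ k • S k)⁺ ≤ v k + ((1 : ℝ) / 2) ^ k • Y :=
    sup_le (sub_le_iff_le_add.1 (le_posPart _)) (add_nonneg (posPart_nonneg _) (hY k))
  have h3 := StrongDual.mono_of_nonneg hf h2
  rw [map_add, map_smul, smul_eq_mul] at h3
  linarith [hK k hkK]

/-- Along a weakly convergent sequence, unbounded absolute weak nullity of a net implies absolute
weak nullity. -/
theorem WeakTendsto.tendsto_apply_abs_of_inf [CompleteSpace E] {y : ℕ → E} {b : E}
    (hy : WeakTendsto y atTop b) {κ : Type*} {l : Filter κ} {φ : κ → ℕ}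
    (h : ∀ u : E, 0 ≤ u → WeakTendsto (fun i => |y (φ i)| ⊓ u) l 0)
    {f : StrongDual ℝ E} (hf : ∀ x, 0 ≤ x → 0 ≤ f x) :
    Tendsto (fun i => f |y (φ i)|) l (𝓝 0) := by
  rw [Metric.tendsto_nhds]
  intro ε hε
  obtain ⟨u, hu, hyu⟩ := hy.exists_posPart_abs_sub_le hf (half_pos hε)
  have h1 := weakTendsto_iff.1 (h u hu) f
  rw [map_zero] at h1
  filter_upwards [h1.eventually (gt_mem_nhds (half_pos hε))] with i hi
  have h2 : f |y (φ i)| = f (|y (φ i)| ⊓ u) + f (|y (φ i)| - u)⁺ := by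
    rw [← map_add, inf_eq_sub_posPart_sub, sub_add_cancel]
  rw [Real.dist_eq, sub_zero, abs_of_nonneg (hf _ (abs_nonneg _)), h2]
  linarith [hyu (φ i)]

end BanachLattice

/-! ### The equivalence. -/

theorem proposition3p20 {E : Type*} [NormedAddCommGroup E] [NormedSpace ℝ E] [CompleteSpace E]
    [Lattice E] [IsOrderedAddMonoid E] [IsOrderedModule ℝ E] [HasSolidNorm E] :
    WeaklySeqContinuousLatticeOps E ↔
      ∀ A : Set E, RelativelyWeaklyCompact A → RelativelyUawCompact A := by
  constructor
  · intro h A hA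
    refine ⟨hA.isBounded, fun ι _ _ _ x hx => ?_⟩
    -- Compactness makes an ultrafilter finer than `atTop` converge weakly; a directed set mapping
    -- into it supplies the subnet.
    let F : Ultrafilter ι := Ultrafilter.of atTop
    obtain ⟨w, -, hw⟩ := hA.ultrafilter_le_nhds (F.map fun i => toWeakSpace ℝ E (x i))
      (le_principal_iff.2 (mem_map.2
        (Eventually.of_forall fun i => subset_closure ⟨_, hx i, rfl⟩)))
    obtain ⟨a, rfl⟩ := (toWeakSpace ℝ E).surjective w
    obtain ⟨κ, P, hdir, hne, φ, hφ⟩ := Filter.exists_directed_tendsto (F : Filter ι)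
    refine ⟨κ, P, hdir, hne, φ, hφ.mono_right (Ultrafilter.of_le atTop), a, fun u hu => ?_⟩
    have hxa : WeakTendsto (x ∘ φ) atTop a := WeakTendsto.comp (x := x) hw hφ
    have := hA.weakTendsto_comp (g := fun z => |z - a| ⊓ u) (fun z hz => ?_) (fun i => hx (φ i)) hxa
    · simpa [inf_eq_left.2 hu] using this
    · have h1 := hz.sub (WeakTendsto.const atTop a)
      -- The modulus is obtained as `(z - a) ⊔ -(z - a)`.
      exact (h _ _ _ _ (h _ _ _ _ h1 h1.neg).1 (WeakTendsto.const atTop u)).2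
  · intro h
    refine weaklySeqContinuousLatticeOps_of_abs fun x hx f hf => ?_
    by_contra hcon
    rw [Metric.tendsto_nhds] at hcon
    push Not at hcon
    obtain ⟨ε, hε, hfr⟩ := hcon
    obtain ⟨θ, hθ, hge⟩ := extraction_of_frequently_atTop hfr
    have hxθ : WeakTendsto (x ∘ θ) atTop 0 := hx.comp hθ.tendsto_atTop
    -- `ULift` moves the index set `ℕ` into the universe of `E`.
    obtain ⟨κ, _, _, _, ψ, hψ, a, ha⟩ := (h _ hxθ.relativelyWeaklyCompact_range).2 (ULift ℕ)
      (fun i => x (θ i.down)) fun i => ⟨i.down, rfl⟩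
    have hdown : Tendsto (fun i => (ψ i).down) atTop atTop :=
      tendsto_atTop.2 fun N => (tendsto_atTop.1 hψ (ULift.up N)).mono fun i hi => hi
    have hlim {g : StrongDual ℝ E} (hg : ∀ z, 0 ≤ z → 0 ≤ g z) :=
      (hxθ.sub (WeakTendsto.const atTop a)).tendsto_apply_abs_of_inf
        (φ := fun i => (ψ i).down) ha hg
    have hxa : WeakTendsto (fun i => x (θ (ψ i).down)) atTop a :=
      weakTendsto_of_forall_nonneg fun g hg => hlim hg
    have hx0 : WeakTendsto (fun i => x (θ (ψ i).down)) atTop 0 := hxθ.comp hdown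
    obtain rfl := hxa.unique hx0
    obtain ⟨i, hi⟩ := (Metric.tendsto_nhds.1 (hlim hf) ε hε).exists
    have := hge (ψ i).down
    simp only [Function.comp_apply, sub_zero] at hi
    exact absurd hi (not_lt.2 this)
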